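/- Let $G=(V,E)$ be a finite simple graph with $n=|V|$ vertices that is chordal (every cycle of length at least four has a chord, i.e. an edge of $G$ joining two vertices of the cycle that are not consecutive on it), and let $(G,p)$ be a framework, $p:V\to\mathbb{R}^d$ an arbitrary configuration. Let $e$ be the all-ones vector, let $\mathcal{K}=\{X\in\mathcal{S}^n : X\succeq 0,\ Xe=0\}$ be the cone of centered positive semidefinite matrices, and let $\hat X\in\mathcal{K}$ be the Gram matrix of the points $p_i-\frac1n\sum_j p_j$. All inner products of matrices are trace inner products. For a stress $\omega:E\to\mathbb{R}$ let $\Omega(\omega)$ be the symmetric matrix with off-diagonal entries $-\omega_{ij}$ for $ij\in E$ (and $0$ for non-adjacent $i\ne j$) and diagonal entries $\sum_{j}\omega_{ij}$. A sequence of $k$ levels of PSD stress matrices of $(G,p)$ consists of stress matrices $\Omega_1,\dots,\Omega_k$ of this form such that, with $\mathcal{F}_0=\mathcal{K}$ and $\mathcal{F}_i=\mathcal{F}_{i-1}\cap\Omega_i^{\perp}$, one has for every $i$: $\langle\Omega_i,\hat X\rangle=0$, $\Omega_i\in\mathcal{F}_{i-1}^*$ and $\Omega_i\notin\mathcal{F}_{i-1}^{\perp}$.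 (For $i=1$ this says exactly that $\Omega_1$ is a nonzero positive semidefinite equilibrium stress matrix of $(G,p)$.) The level of PSD stress matrices of $(G,p)$ is the minimal length of such a sequence that cannot be extended by a further $\Omega_{k+1}$. Let $d_E=(\|p_i-p_j\|^2)_{ij\in E}$, let $K(X)_{ij}=X_{ii}+X_{jj}-2X_{ij}$, let $\Pi_E$ be the projection of a symmetric matrix to its entries indexed by $E$, and put $\mathcal{M}=\Pi_E\circ K$. The EDM completion problem of $(G,p)$ is to find $X\in\mathcal{K}$ with $\mathcal{M}(X)=d_E$. Its singularity degree is the smallest number $k$ of facial reduction steps $\mathcal{F}_0=\mathcal{K}$, $\mathcal{F}_i=\mathcal{F}_{i-1}\cap(\mathcal{M}^*v_i)^{\perp}$, where $\mathcal{M}^*v_i\in\mathcal{F}_{i-1}^*$, $\mathcal{M}^*v_i\notin\mathcal{F}_{i-1}^{\perp}$ and $\langle v_i,d_E\rangle=0$, after which $\mathcal{F}_k$ is the minimal face of $\mathcal{K}$ containing the feasible region $\{X\in\mathcal{K}:\mathcal{M}(X)=d_E\}$. Then the level of PSD stress matrices of $(G,p)$ is at most $1$. Equivalently, the singularity degree of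 the EDM completion problem of $(G,p)$, which equals this level, is at most $1$. -/

import Mathlib

open scoped InnerProductSpace Matrix

noncomputable section

/-! ### Faces, facial reduction and singularity degree -/

/-- `f` is a face of the convex set `C`: a convex subset that contains every segment of `C`
whose relative interior meets it. -/
def IsFace {E : Type*} [AddCommGroup E] [Module ℝ E] (C f : Set E) : Prop :=
  Convex ℝ f ∧ IsExtreme ℝ C f

/-- `face(S, C)`: the intersection of all faces of `C` that contain `S`. -/
def minFace {E : Type*} [AddCommGroup E] [Module ℝ E] (C S : Set E) : Set E :=
  ⋂₀ {f | IsFace C f ∧ S ⊆ f}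

section FacialReduction

variable {E F : Type*} [AddCommGroup E] [Module ℝ E]
  [NormedAddCommGroup F] [InnerProductSpace ℝ F]

/-- The feasible region `{X ∈ K : M X = b}`. -/
def feasibleRegion (K : ConvexCone ℝ E) (M : E →ₗ[ℝ] F) (b : F) : Set E :=
  {X | X ∈ K ∧ M X = b}

/-- `v` is a reducing certificate for the current face `f`: the vector `Z = M* v` lies in the dual
cone of `f`, does not lie in `f^⊥`, and `⟪v, b⟫ = 0`. By the definition of the adjoint, `⟪Z, X⟫`
is `⟪v, M X⟫`. -/
def IsReducingCertificate (M : E →ₗ[ℝ] F) (b : F) (f : Set E) (v : F) : Prop :=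
  (∀ X ∈ f, 0 ≤ ⟪v, M X⟫_ℝ) ∧ (∃ X ∈ f, ⟪v, M X⟫_ℝ ≠ 0) ∧ ⟪v, b⟫_ℝ = 0

/-- `FacialReduction K M b k f`: some run of the facial reduction algorithm for the system
`X ∈ K, M X = b` arrives at `f` after exactly `k` steps. A step replaces `f` by `f ∩ (M* v)^⊥` for
a reducing certificate `v`. -/
inductive FacialReduction (K : ConvexCone ℝ E) (M : E →ₗ[ℝ] F) (b : F) : ℕ → Set E → Prop
  | start : FacialReduction K M b 0 (K : Set E)
  | step {k : ℕ} {f : Set E} (v : F) : FacialReduction K M b k f →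
      IsReducingCertificate M b f v →
      FacialReduction K M b (k + 1) {X | X ∈ f ∧ ⟪v, M X⟫_ℝ = 0}

/-- The singularity degree of the system `X ∈ K, M X = b`: the smallest number of steps of facial
reduction that leads to the minimal face of `K` containing the feasible region
(`⊤` if this face is never reached). -/
def singularityDegree (K : ConvexCone ℝ E) (M : E →ₗ[ℝ] F) (b : F) : ℕ∞ :=
  ⨅ (k : ℕ) (_ : FacialReduction K M b k (minFace (K : Set E) (feasibleRegion K M b))), (k : ℕ∞)

end FacialReduction

/-! ### The Euclidean distance matrix completion problem -/

/-- The space of symmetric real matrices with rows and columns indexed by `V`. -/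
def SymMat (V : Type*) : Submodule ℝ (Matrix V V ℝ) where
  carrier := {A | A.IsSymm}
  add_mem' := fun ha hb => Matrix.IsSymm.add ha hb
  zero_mem' := Matrix.isSymm_zero
  smul_mem' := fun c _ ha => Matrix.IsSymm.smul ha c

/-- The cone of centered positive semidefinite matrices: `X ⪰ 0` and `X e = 0`, where `e` is the
all-ones vector. -/
def centeredPSD (V : Type*) [Fintype V] : ConvexCone ℝ (SymMat V) where
  carrier := {X | X.1.PosSemidef ∧ X.1 *ᵥ 1 = 0}
  add_mem' := by
    rintro X ⟨hX, hX1⟩ Y ⟨hY, hY1⟩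
    refine ⟨hX.add hY, ?_⟩
    change (X.1 + Y.1) *ᵥ 1 = 0
    rw [Matrix.add_mulVec, hX1, hY1, add_zero]
  smul_mem' := by
    rintro c hc X ⟨hX, hX1⟩
    refine ⟨hX.smul hc.le, ?_⟩
    change (c • X.1) *ᵥ 1 = 0
    rw [Matrix.smul_mulVec, hX1, smul_zero]

/-- The Lindenstrauss map `K(X)_{ij} = X_{ii} + X_{jj} - 2 X_{ij}`. -/
def lindenstrauss (V : Type*) : SymMat V →ₗ[ℝ] SymMat V where
  toFun X := ⟨Matrix.of fun i j => X.1 i i + X.1 j j - 2 * X.1 i j, by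
    ext i j
    have h : X.1 j i = X.1 i j := Matrix.IsSymm.apply X.2 i j
    simp only [Matrix.transpose_apply, Matrix.of_apply, h]
    ring⟩
  map_add' X Y := by
    ext i j
    simp only [Submodule.coe_add, Matrix.add_apply, Matrix.of_apply]
    ring
  map_smul' c X := by
    ext i j
    simp only [Submodule.coe_smul, Matrix.smul_apply, Matrix.of_apply, smul_eq_mul,
      RingHom.id_apply]
    ring

theorem trace_mul_vecMulVec_self {V : Type*} [Fintype V] (A : Matrix V V ℝ) (x : V → ℝ) :
    (A * Matrix.vecMulVec x x).trace = x ⬝ᵥ (A *ᵥ x) := by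
  rw [Matrix.mul_vecMulVec, Matrix.trace_vecMulVec, dotProduct_comm]

open scoped MatrixOrder in
theorem trace_mul_nonneg_of_posSemidef {V : Type*} [Fintype V] [DecidableEq V]
    {A B : Matrix V V ℝ} (hA : A.PosSemidef) (hB : B.PosSemidef) : 0 ≤ (A * B).trace := by
  obtain ⟨C, rfl⟩ := CStarAlgebra.nonneg_iff_eq_star_mul_self.mp hB.nonneg
  rw [Matrix.star_eq_conjTranspose, ← Matrix.mul_assoc, Matrix.trace_mul_comm, ← Matrix.mul_assoc]
  exact (hA.mul_mul_conjTranspose_same C).trace_nonneg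

section Graph

variable {V : Type*} [Fintype V] [DecidableEq V] (G : SimpleGraph V) [DecidableRel G.Adj]

/-- The projection `Π_E` of a symmetric matrix to its entries at the edges of `G`. -/
def edgeProj : SymMat V →ₗ[ℝ] EuclideanSpace ℝ G.edgeSet where
  toFun D := WithLp.toLp 2 fun e =>
    Sym2.lift ⟨fun i j => D.1 i j, fun i j => Matrix.IsSymm.apply D.2 j i⟩ e.1
  map_add' D D' := by
    ext ⟨e, he⟩
    induction e using Sym2.ind with
    | _ i j => simp
  map_smul' c D := by
    ext ⟨e, he⟩
    induction e using Sym2.ind with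
    | _ i j => simp

/-- The squared edge lengths `d_E` of the framework `(G, p)`. -/
def edgeSqDist {d : ℕ} (p : V → EuclideanSpace ℝ (Fin d)) : EuclideanSpace ℝ G.edgeSet :=
  WithLp.toLp 2 fun e =>
    Sym2.lift ⟨fun i j => ‖p i - p j‖ ^ 2, fun i j => by simp only [norm_sub_rev]⟩ e.1

/-- The singularity degree of the EDM completion problem with data `a`: find `X ⪰ 0` with `X e = 0`
and `Π_E (K X) = a`. -/
def edmSingularityDegree (a : EuclideanSpace ℝ G.edgeSet) : ℕ∞ :=
  singularityDegree (centeredPSD V) (edgeProj G ∘ₗ lindenstrauss V) a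

/-! ### Stress matrices of a framework -/

/-- The weight `ω_{ij}`, extended by zero to pairs that are not edges. -/
def stressWeight (ω : G.edgeSet → ℝ) (i j : V) : ℝ :=
  if h : G.Adj i j then ω ⟨s(i, j), h⟩ else 0

/-- The stress matrix `Ω(ω)`: off-diagonal entries `-ω_{ij}`, diagonal entries `∑ j, ω_{ij}`. -/
def stressMatrix (ω : G.edgeSet → ℝ) : Matrix V V ℝ :=
  Matrix.of fun i j => if i = j then ∑ k, stressWeight G ω i k else -stressWeight G ω i j

/-- `ω` is an equilibrium stress of `(G, p)`: the net stress at every vertex is zero. -/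
def IsEquilibriumStress {d : ℕ} (p : V → EuclideanSpace ℝ (Fin d)) (ω : G.edgeSet → ℝ) : Prop :=
  ∀ i, ∑ j, stressWeight G ω i j • (p i - p j) = 0

/-- The Gram matrix `X̂` of the configuration `p`, translated so that its centroid is zero. -/
def centeredGram {d : ℕ} (p : V → EuclideanSpace ℝ (Fin d)) : Matrix V V ℝ :=
  Matrix.gram ℝ fun i => p i - (Fintype.card V : ℝ)⁻¹ • ∑ j, p j

/-- `ω` provides a nonzero PSD stress matrix of `(G, p)` relative to the face `f` of the cone of
centered PSD matrices: `⟪Ω, X̂⟫ = 0`, and `Ω` lies in the dual cone of `f` but not in `f^⊥`, for the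
trace inner product. At the first level, where `f` is the whole cone, this says that `Ω` is a
nonzero positive semidefinite equilibrium stress matrix; see `isPSDStressOn_centeredPSD_iff`. -/
def IsPSDStressOn {d : ℕ} (p : V → EuclideanSpace ℝ (Fin d)) (f : Set (SymMat V))
    (ω : G.edgeSet → ℝ) : Prop :=
  (stressMatrix G ω * centeredGram p).trace = 0 ∧
    (∀ X ∈ f, 0 ≤ (stressMatrix G ω * X.1).trace) ∧
    ∃ X ∈ f, (stressMatrix G ω * X.1).trace ≠ 0


set_option linter.unusedSectionVars false in
theorem stressWeight_comm (ω : G.edgeSet → ℝ) (i j : V) :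
    stressWeight G ω i j = stressWeight G ω j i := by
  unfold stressWeight
  by_cases h : G.Adj i j
  · rw [dif_pos h, dif_pos h.symm]
    congr 1
    exact Subtype.ext Sym2.eq_swap
  · rw [dif_neg h, dif_neg fun h' => h h'.symm]

theorem stressMatrix_mulVec (ω : G.edgeSet → ℝ) (x : V → ℝ) (i : V) :
    (stressMatrix G ω *ᵥ x) i = ∑ j, stressWeight G ω i j * (x i - x j) := by
  have h0 : stressWeight G ω i i = 0 := by simp [stressWeight]
  have h : ∀ j, stressMatrix G ω i j * x j =
      (if i = j then (∑ k, stressWeight G ω i k) * x i else 0) - stressWeight G ω i j * x j := by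
    intro j
    by_cases hij : i = j
    · subst hij
      simp [stressMatrix, h0]
    · simp [stressMatrix, hij]
  simp only [Matrix.mulVec, dotProduct, h, Finset.sum_sub_distrib, mul_sub, Finset.sum_ite_eq,
    Finset.mem_univ, if_true, Finset.sum_mul]

theorem stressMatrix_isSymm (ω : G.edgeSet → ℝ) : (stressMatrix G ω).IsSymm := by
  ext i j
  by_cases h : i = j
  · subst h; rfl
  · simp [stressMatrix, h, Ne.symm h, stressWeight_comm G ω i j]

theorem isEquilibriumStress_iff {d : ℕ} (p : V → EuclideanSpace ℝ (Fin d)) (ω : G.edgeSet → ℝ) :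
    IsEquilibriumStress G p ω ↔ ∀ c, stressMatrix G ω *ᵥ (fun i => p i c) = 0 := by
  constructor
  · intro h c
    ext i
    have := congrArg (fun v : EuclideanSpace ℝ (Fin d) => v c) (h i)
    simpa [stressMatrix_mulVec] using this
  · intro h i
    ext c
    have := congrFun (h c) i
    simpa [stressMatrix_mulVec] using this

theorem trace_mul_centeredGram {d : ℕ} (p : V → EuclideanSpace ℝ (Fin d)) (ω : G.edgeSet → ℝ) :
    (stressMatrix G ω * centeredGram p).trace =
      ∑ c, (fun i => p i c) ⬝ᵥ (stressMatrix G ω *ᵥ fun i => p i c) := by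
  set m := (Fintype.card V : ℝ)⁻¹ • ∑ j, p j with hm
  have key : ∀ c, (stressMatrix G ω *ᵥ fun i => p i c) =
      stressMatrix G ω *ᵥ fun i => p i c - m c := by
    intro c
    ext i
    simp only [stressMatrix_mulVec]
    exact Finset.sum_congr rfl fun j _ => by ring
  have hcol : ∀ c, (fun _ => m c) ⬝ᵥ (stressMatrix G ω *ᵥ fun i => p i c) = 0 := by
    intro c
    rw [Matrix.dotProduct_mulVec, ← Matrix.mulVec_transpose, (stressMatrix_isSymm G ω).eq]
    have : stressMatrix G ω *ᵥ (fun _ => m c) = 0 := by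
      ext i
      simp [stressMatrix_mulVec]
    rw [this, zero_dotProduct]
  have h2 : ∀ c, (fun i => p i c) ⬝ᵥ (stressMatrix G ω *ᵥ fun i => p i c) =
      (fun i => p i c - m c) ⬝ᵥ (stressMatrix G ω *ᵥ fun i => p i c - m c) := by
    intro c
    rw [← key c]
    have : (fun i => p i c - m c) = (fun i => p i c) - fun _ => m c := rfl
    rw [this, sub_dotProduct, hcol c, sub_zero]
  rw [Finset.sum_congr rfl fun c _ => h2 c]
  simp only [Matrix.trace, Matrix.diag, Matrix.mul_apply, centeredGram, Matrix.gram_apply,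
    dotProduct, Matrix.mulVec, PiLp.inner_apply, ← hm, Finset.mul_sum]
  conv_rhs => rw [Finset.sum_comm]
  refine Finset.sum_congr rfl fun i _ => ?_
  conv_rhs => rw [Finset.sum_comm]
  refine Finset.sum_congr rfl fun j _ => Finset.sum_congr rfl fun c _ => ?_
  simp
  ring

/-- At the first level, a PSD stress matrix is exactly a nonzero positive semidefinite equilibrium
stress matrix of the framework. -/
theorem isPSDStressOn_centeredPSD_iff {d : ℕ} (p : V → EuclideanSpace ℝ (Fin d))
    (ω : G.edgeSet → ℝ) :
    IsPSDStressOn G p (centeredPSD V : Set (SymMat V)) ω ↔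
      (stressMatrix G ω).PosSemidef ∧ stressMatrix G ω ≠ 0 ∧ IsEquilibriumStress G p ω := by
  have hherm : (stressMatrix G ω).IsHermitian := by
    rw [Matrix.IsHermitian, Matrix.conjTranspose_eq_transpose_of_trivial]
    exact stressMatrix_isSymm G ω
  -- the rank one test matrix of a centered vector
  have test : ∀ x : V → ℝ, ∃ X ∈ (centeredPSD V : Set (SymMat V)),
      (stressMatrix G ω * X.1).trace = x ⬝ᵥ (stressMatrix G ω *ᵥ x) := by
    intro x
    set m := (Fintype.card V : ℝ)⁻¹ * ∑ j, x j with hm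
    set y : V → ℝ := fun i => x i - m with hy
    have hsum : ∑ i, y i = 0 := by
      rcases isEmpty_or_nonempty V with hV | hV
      · simp
      · simp [hy, hm, Finset.sum_sub_distrib]
    refine ⟨⟨Matrix.vecMulVec y y, ?_⟩, ⟨?_, ?_⟩, ?_⟩
    · ext i j
      simp [Matrix.vecMulVec_apply, mul_comm]
    · simpa using Matrix.posSemidef_vecMulVec_self_star y
    · ext i
      simp [Matrix.mulVec, dotProduct, Matrix.vecMulVec_apply, ← Finset.mul_sum, hsum]
    · change (stressMatrix G ω * Matrix.vecMulVec y y).trace = _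
      rw [trace_mul_vecMulVec_self]
      have h1 : stressMatrix G ω *ᵥ y = stressMatrix G ω *ᵥ x := by
        ext i
        simp [stressMatrix_mulVec, hy]
      have h0 : stressMatrix G ω *ᵥ (fun _ => m) = 0 := by
        ext i
        simp [stressMatrix_mulVec]
      have h2 : y = x - fun _ => m := rfl
      rw [h1, h2, sub_dotProduct, Matrix.dotProduct_mulVec (fun _ => m), ← Matrix.mulVec_transpose,
        (stressMatrix_isSymm G ω).eq, h0, zero_dotProduct, sub_zero]
  constructor
  · rintro ⟨htr, hpos, X, hX, hXne⟩
    have hpsd : (stressMatrix G ω).PosSemidef := by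
      refine Matrix.PosSemidef.of_dotProduct_mulVec_nonneg hherm fun x => ?_
      obtain ⟨X, hX, hXe⟩ := test x
      simpa [hXe] using hpos X hX
    refine ⟨hpsd, fun h => hXne (by simp [h]), ?_⟩
    rw [isEquilibriumStress_iff]
    intro c
    rw [trace_mul_centeredGram, Finset.sum_eq_zero_iff_of_nonneg] at htr
    · have := htr c (Finset.mem_univ c)
      exact (hpsd.dotProduct_mulVec_zero_iff _).mp (by simpa using this)
    · intro c _
      simpa using hpsd.dotProduct_mulVec_nonneg fun i => p i c
  · rintro ⟨hpsd, hne, heq⟩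
    refine ⟨?_, ?_, ?_⟩
    · rw [trace_mul_centeredGram]
      refine Finset.sum_eq_zero fun c _ => ?_
      rw [(isEquilibriumStress_iff G p ω).mp heq c, dotProduct_zero]
    · rintro X ⟨hX, -⟩
      exact trace_mul_nonneg_of_posSemidef hpsd hX
    · by_contra! hcon
      apply hne
      have hz : ∀ x, stressMatrix G ω *ᵥ x = 0 := by
        intro x
        obtain ⟨X, hX, hXe⟩ := test x
        rw [hcon X hX] at hXe
        exact (hpsd.dotProduct_mulVec_zero_iff x).mp (by simpa using hXe.symm)
      ext i j
      have := congrFun (hz (Pi.single j 1)) i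
      simpa using this

/-- `PSDStressLevels G p k f`: there is a sequence `Ω_1, …, Ω_k` of PSD stress matrices of `(G, p)`,
each relative to the face cut out by the previous ones, and `f` is the face of the centered PSD
cone cut out by all of them. -/
inductive PSDStressLevels {d : ℕ} (p : V → EuclideanSpace ℝ (Fin d)) :
    ℕ → Set (SymMat V) → Prop
  | start : PSDStressLevels p 0 (centeredPSD V : Set (SymMat V))
  | step {k : ℕ} {f : Set (SymMat V)} (ω : G.edgeSet → ℝ) : PSDStressLevels p k f →
      IsPSDStressOn G p f ω →
      PSDStressLevels p (k + 1) {X | X ∈ f ∧ (stressMatrix G ω * X.1).trace = 0}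

/-- The level of PSD stress matrices of `(G, p)` (its singularity degree as a framework): the
minimal length of a sequence of levels of PSD stress matrices that cannot be continued
(`⊤` if there is no such sequence). -/
def psdStressLevel {d : ℕ} (p : V → EuclideanSpace ℝ (Fin d)) : ℕ∞ :=
  ⨅ (k : ℕ) (_ : ∃ f, PSDStressLevels G p k f ∧ ¬ ∃ ω, IsPSDStressOn G p f ω), (k : ℕ∞)


end Graph

/-- A graph is chordal if every cycle of length at least four has a chord, that is, an edge of the
graph that joins two vertices of the cycle and is not an edge of the cycle. -/
def IsChordal {V : Type*} (G : SimpleGraph V) : Prop :=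
  ∀ (u : V) (c : G.Walk u u), c.IsCycle → 4 ≤ c.length →
    ∃ x ∈ c.support, ∃ y ∈ c.support, G.Adj x y ∧ s(x, y) ∉ c.edges

end

/-!
For a chordal graph a single stress already cuts out the minimal face, so facial reduction needs at
most one step. The reason is that `(G, p)` has a strictly complementary pair: a configuration `q`
with the edge lengths of `p`, and a positive semidefinite stress matrix `Ω` of `G` whose kernel
consists exactly of the affine functions of `q`.

The pair is built vertex by vertex along a perfect elimination ordering, which exists by Dirac's
theorem (`IsChordal.exists_simplicial`). Let `v` be the next vertex, and let `N` be the clique of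
its neighbours among the vertices already placed. The points of `N` are congruent in `p` and in `q`.
If `p v` lies off the affine span of the points of `N`, then `v` is placed at the right distances
using a new dimension, and `Ω` is kept. Otherwise `p v` is an affine combination of these points,
`v` is placed at the same combination of the points of `q`, and the square of the linear form that
expresses this dependence, which is supported on the clique `N ∪ {v}`, is added to `Ω`
(`IsComplementaryPair.exists_insert`).

A centered positive semidefinite matrix orthogonal to `Ω` is a sum of squares of affine functions
of `q`, hence is dominated by a multiple of the Gram matrix of `q`, which is feasible
(`IsComplementaryPair.exists_smul_sub_mem`). So every face containing the feasible region contains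
it, and the face exposed by `Ω` is the minimal one (`IsChordal.exists_stress_eq_minFace`).

The stress matrix `Ω(ω)` is the image of `ω` under the adjoint of the edge measurement map
(`trace_stressMatrix_mul`). Hence sequences of levels of PSD stress matrices are the same as runs of
facial reduction, and a run that has reached the minimal face cannot be continued. Both invariants
are therefore `0` if `Ω` is orthogonal to the whole cone, and `1` otherwise.
-/

/-! ### Simplicial vertices of chordal graphs -/

/-- A chord of a walk gives a shortcut. -/
theorem SimpleGraph.Walk.exists_length_lt_of_chord {V : Type*} {G : SimpleGraph V} {x y a b : V}
    (q : G.Walk x y) (ha : a ∈ q.support) (hb : b ∈ q.support) (hab : G.Adj a b)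
    (he : s(a, b) ∉ q.edges) :
    ∃ q' : G.Walk x y, q'.length < q.length ∧ ∀ z ∈ q'.support, z ∈ q.support := by
  obtain ⟨i, rfl, hi⟩ := SimpleGraph.Walk.mem_support_iff_exists_getVert.mp ha
  obtain ⟨j, rfl, hj⟩ := SimpleGraph.Walk.mem_support_iff_exists_getVert.mp hb
  clear ha hb
  wlog hij : i < j generalizing i j
  · have hne : i ≠ j := fun h => hab.ne (by rw [h])
    exact this j hj i hi hab.symm (by rwa [Sym2.eq_swap]) (by omega)
  have hne : j ≠ i + 1 := by
    rintro rfl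
    exact he (q.mk_mem_edges_iff_exists.mpr ⟨i, by omega, rfl⟩)
  refine ⟨(q.take i).append (.cons hab (q.drop j)), ?_, ?_⟩
  · simp only [SimpleGraph.Walk.length_append, SimpleGraph.Walk.length_cons,
      SimpleGraph.Walk.take_length, SimpleGraph.Walk.drop_length]
    omega
  · intro z hz
    rw [SimpleGraph.Walk.mem_support_append_iff, SimpleGraph.Walk.support_cons, List.mem_cons] at hz
    rcases hz with hz | rfl | hz
    · exact (q.isSubwalk_take i).support_subset hz
    · exact q.getVert_mem_support i
    · exact (q.isSubwalk_drop j).support_subset hz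

/-- In a chordal graph, two neighbours `x`, `y` of a connected set `A` with a common neighbour `r`
that has no neighbour in `A` are adjacent: otherwise `r` and a shortest path from `x` to `y`
through `A` form a cycle without a chord. -/
theorem IsChordal.adj_of_walk_of_common_neighbor {V : Type*} {G : SimpleGraph V} (hG : IsChordal G)
    {A : Set V} {x y r : V} (hxy : x ≠ y) (hrx : G.Adj r x) (hry : G.Adj r y) (hrA : r ∉ A)
    (hr : ∀ a ∈ A, ¬ G.Adj r a)
    (hw : ∃ q : G.Walk x y, ∀ z ∈ q.support, z ∈ A ∨ z = x ∨ z = y) : G.Adj x y := by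
  classical
  by_contra hnadj
  have hne : {n | ∃ q : G.Walk x y, q.length = n ∧
      ∀ z ∈ q.support, z ∈ A ∨ z = x ∨ z = y}.Nonempty := by
    obtain ⟨q, hq⟩ := hw
    exact ⟨_, q, rfl, hq⟩
  obtain ⟨q, hqlen, hq⟩ := Nat.sInf_mem hne
  have hmin : ∀ q' : G.Walk x y, q'.length < q.length →
      ¬ ∀ z ∈ q'.support, z ∈ A ∨ z = x ∨ z = y := by
    intro q' hlt h
    have := Nat.sInf_le (s := {n | ∃ q : G.Walk x y, q.length = n ∧
      ∀ z ∈ q.support, z ∈ A ∨ z = x ∨ z = y}) ⟨q', rfl, h⟩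
    omega
  have hpath : q.IsPath := by
    have hle : q.length ≤ q.bypass.length := by
      by_contra! hlt
      exact hmin _ hlt fun z hz => hq z (q.support_bypass_subset_support hz)
    rw [← SimpleGraph.Walk.bypass_eq_self_of_length_le_length_bypass q hle]
    exact q.bypass_isPath
  have hrq : r ∉ q.support := fun h => by
    rcases hq r h with h | h | h
    · exact hrA h
    · exact hrx.ne h
    · exact hry.ne h
  have hqlen2 : 2 ≤ q.length := by
    by_contra! hlt
    rcases Nat.lt_or_ge q.length 1 with h0 | h1
    · exact hxy (SimpleGraph.Walk.eq_of_length_eq_zero (by omega : q.length = 0))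
    · exact hnadj (SimpleGraph.Walk.adj_of_length_eq_one (by omega : q.length = 1))
  have hcyc : (SimpleGraph.Walk.cons hrx (q.concat hry.symm)).IsCycle := by
    rw [SimpleGraph.Walk.cons_isCycle_iff]
    refine ⟨hpath.concat hrq hry.symm, ?_⟩
    rw [SimpleGraph.Walk.edges_concat, List.concat_eq_append, List.mem_append, List.mem_singleton]
    rintro (h | h)
    · exact hrq (q.fst_mem_support_of_mem_edges h)
    · rw [Sym2.eq_swap, Sym2.congr_left] at h
      exact hxy h
  obtain ⟨a, ha, b, hb, hab, he⟩ := hG r _ hcyc (by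
    simp only [SimpleGraph.Walk.length_cons, SimpleGraph.Walk.length_concat]
    omega)
  have hsupp : ∀ z, z ∈ (SimpleGraph.Walk.cons hrx (q.concat hry.symm)).support →
      z = r ∨ z ∈ q.support := by
    intro z hz
    simp only [SimpleGraph.Walk.support_cons, SimpleGraph.Walk.support_concat, List.mem_cons,
      List.mem_append, List.not_mem_nil, or_false] at hz
    tauto
  simp only [SimpleGraph.Walk.edges_cons, SimpleGraph.Walk.edges_concat, List.concat_eq_append,
    List.mem_cons, List.mem_append, List.not_mem_nil, or_false, not_or] at he
  -- a neighbour of `r` on the path is one of its two ends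
  have hrz : ∀ z ∈ q.support, G.Adj r z → z = x ∨ z = y := fun z hz hadj =>
    (hq z hz).resolve_left fun hzA => hr z hzA hadj
  rcases hsupp a ha with rfl | haq
  · rcases hsupp b hb with rfl | hbq
    · exact hab.ne rfl
    · rcases hrz b hbq hab with rfl | rfl
      · exact he.1 rfl
      · exact he.2.2 Sym2.eq_swap
  · rcases hsupp b hb with rfl | hbq
    · rcases hrz a haq hab.symm with rfl | rfl
      · exact he.1 Sym2.eq_swap
      · exact he.2.2 rfl
    · obtain ⟨q', hlt, hsub⟩ := q.exists_length_lt_of_chord haq hbq hab he.2.1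
      exact hmin q' hlt fun z hz => hq z (hsub z hz)

/-- Dirac's theorem for induced subgraphs: a nonempty set `S` of vertices of a chordal graph
contains a vertex whose neighbours in `S` form a clique. If `S` is not a clique, take a maximal
connected `A ⊆ S` such that some vertices `R` of `S` are neither in `A` nor adjacent to `A`.
The remaining vertices of `S` form a clique and are all adjacent to all of `R`, so a simplicial
vertex of `R` is simplicial in `S`. -/
theorem IsChordal.exists_simplicial {V : Type*} {G : SimpleGraph V} (hG : IsChordal G)
    (S : Finset V) (hS : S.Nonempty) :
    ∃ v ∈ S, ∀ x ∈ S, ∀ y ∈ S, G.Adj v x → G.Adj v y → x ≠ y → G.Adj x y := by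
  classical
  induction S using Finset.strongInduction with
  | H S ih =>
  by_cases hcl : ∀ x ∈ S, ∀ y ∈ S, x ≠ y → G.Adj x y
  · obtain ⟨v, hv⟩ := hS
    exact ⟨v, hv, fun x hx y hy _ _ hxy => hcl x hx y hy hxy⟩
  push Not at hcl
  obtain ⟨u, hu, u', hu', huu', hnadj⟩ := hcl
  let good : Finset V → Prop := fun A => u ∈ A ∧
    (∀ a ∈ A, ∃ w : G.Walk u a, ∀ z ∈ w.support, z ∈ A) ∧
    ∃ r ∈ S, r ∉ A ∧ ∀ a ∈ A, ¬ G.Adj r a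
  have hgood : (S.powerset.filter good).Nonempty := by
    refine ⟨{u}, Finset.mem_filter.mpr ⟨by simpa using hu, by simp, ?_, u', hu', ?_, ?_⟩⟩
    · intro a ha
      obtain rfl := Finset.mem_singleton.mp ha
      exact ⟨.nil, by simp⟩
    · simpa using huu'.symm
    · simpa [G.adj_comm] using hnadj
  obtain ⟨A, hA, hmax⟩ := Finset.exists_max_image _ Finset.card hgood
  obtain ⟨hAS, huA, hconn, r₀, hr₀, hr₀A, hr₀n⟩ := Finset.mem_filter.mp hA
  rw [Finset.mem_powerset] at hAS
  have hfull : ∀ x ∈ S, x ∉ A → (∃ a ∈ A, G.Adj x a) → ∀ r ∈ S, r ∉ A →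
      (∀ a ∈ A, ¬ G.Adj r a) → G.Adj r x := by
    rintro x hx hxA ⟨a, ha, hxa⟩ r hr hrA hrn
    by_contra hrx
    have hmem : insert x A ∈ S.powerset.filter good := by
      refine Finset.mem_filter.mpr ⟨?_, Finset.mem_insert_of_mem huA, ?_, r, hr, ?_, ?_⟩
      · exact Finset.mem_powerset.mpr (Finset.insert_subset hx hAS)
      · intro b hb
        rcases Finset.mem_insert.mp hb with rfl | hb
        · obtain ⟨w, hw⟩ := hconn a ha
          refine ⟨w.concat hxa.symm, fun z hz => ?_⟩
          rw [SimpleGraph.Walk.support_concat, List.mem_append,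
            List.mem_singleton] at hz
          rcases hz with hz | rfl
          · exact Finset.mem_insert_of_mem (hw z hz)
          · exact Finset.mem_insert_self _ _
        · obtain ⟨w, hw⟩ := hconn b hb
          exact ⟨w, fun z hz => Finset.mem_insert_of_mem (hw z hz)⟩
      · rw [Finset.mem_insert, not_or]
        exact ⟨fun h => hrn a ha (h ▸ hxa), hrA⟩
      · intro b hb
        rcases Finset.mem_insert.mp hb with rfl | hb
        · exact hrx
        · exact hrn b hb
    have := hmax _ hmem
    rw [Finset.card_insert_of_notMem hxA] at this
    omega
  have hB : ∀ x ∈ S, x ∉ A → (∃ a ∈ A, G.Adj x a) → ∀ y ∈ S, y ∉ A → (∃ a ∈ A, G.Adj y a) →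
      x ≠ y → G.Adj x y := by
    intro x hx hxA hxa y hy hyA hya hxy
    refine hG.adj_of_walk_of_common_neighbor (A := A) hxy (hfull x hx hxA hxa r₀ hr₀ hr₀A hr₀n)
      (hfull y hy hyA hya r₀ hr₀ hr₀A hr₀n) (by simpa using hr₀A) (by simpa using hr₀n) ?_
    obtain ⟨a, ha, hxa⟩ := hxa
    obtain ⟨b, hb, hyb⟩ := hya
    obtain ⟨w, hw⟩ := hconn a ha
    obtain ⟨w', hw'⟩ := hconn b hb
    refine ⟨.cons hxa (w.reverse.append (w'.concat hyb.symm)), fun z hz => ?_⟩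
    simp only [SimpleGraph.Walk.support_cons, SimpleGraph.Walk.mem_support_append_iff,
      SimpleGraph.Walk.support_concat, List.mem_cons, List.mem_append,
      SimpleGraph.Walk.support_reverse, List.mem_reverse, List.not_mem_nil, or_false] at hz
    rcases hz with rfl | hz | hz | rfl
    · exact Or.inr (Or.inl rfl)
    · exact Or.inl (hw z hz)
    · exact Or.inl (hw' z hz)
    · exact Or.inr (Or.inr rfl)
  have hRS : S.filter (fun r => r ∉ A ∧ ∀ a ∈ A, ¬ G.Adj r a) ⊂ S :=
    Finset.filter_ssubset.mpr ⟨u, hu, fun h => h.1 huA⟩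
  obtain ⟨v, hv, hsimp⟩ := ih _ hRS ⟨r₀, Finset.mem_filter.mpr ⟨hr₀, hr₀A, hr₀n⟩⟩
  obtain ⟨hvS, hvA, hvn⟩ := Finset.mem_filter.mp hv
  refine ⟨v, hvS, fun x hx y hy hvx hvy hxy => ?_⟩
  have hxA : x ∉ A := fun h => hvn x h hvx
  have hyA : y ∉ A := fun h => hvn y h hvy
  by_cases hxa : ∃ a ∈ A, G.Adj x a
  · by_cases hya : ∃ a ∈ A, G.Adj y a
    · exact hB x hx hxA hxa y hy hyA hya hxy
    · push Not at hya
      exact (hfull x hx hxA hxa y hy hyA hya).symm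
  · push Not at hxa
    by_cases hya : ∃ a ∈ A, G.Adj y a
    · exact hfull y hy hyA hya x hx hxA hxa
    · push Not at hya
      exact hsimp x (Finset.mem_filter.mpr ⟨hx, hxA, hxa⟩) y
        (Finset.mem_filter.mpr ⟨hy, hyA, hya⟩) hvx hvy hxy

/-! ### Extending a framework by a vertex that is attached to a clique -/

/-- The distance from one of the points to an affine combination of them depends only on the
distances between the points. -/
theorem norm_sum_smul_sub_eq_of_norm_sub_eq {ι E F : Type*} [NormedAddCommGroup E]
    [InnerProductSpace ℝ E] [NormedAddCommGroup F] [InnerProductSpace ℝ F] (p : ι → E) (q : ι → F)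
    (N : Finset ι) (c : ι → ℝ) (hc : ∑ j ∈ N, c j = 1)
    (h : ∀ i ∈ N, ∀ j ∈ N, ‖q i - q j‖ = ‖p i - p j‖) {i : ι} (hi : i ∈ N) :
    ‖∑ j ∈ N, c j • q j - q i‖ ^ 2 = ‖∑ j ∈ N, c j • p j - p i‖ ^ 2 := by
  classical
  set μ : ι → ℝ := fun j => c j - if j = i then 1 else 0 with hμ
  have hμ0 : ∑ j ∈ N, μ j = 0 := by simp [hμ, Finset.sum_sub_distrib, hc, hi]
  have hq : ∑ j ∈ N, c j • q j - q i = ∑ j ∈ N, μ j • q j := by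
    simp [hμ, sub_smul, Finset.sum_sub_distrib, hi]
  have hp : ∑ j ∈ N, c j • p j - p i = ∑ j ∈ N, μ j • p j := by
    simp [hμ, sub_smul, Finset.sum_sub_distrib, hi]
  rw [hq, hp, ← real_inner_self_eq_norm_sq, ← real_inner_self_eq_norm_sq,
    inner_sum_smul_sum_smul_of_sum_eq_zero _ hμ0 _ hμ0,
    inner_sum_smul_sum_smul_of_sum_eq_zero _ hμ0 _ hμ0]
  congr 2
  exact Finset.sum_congr rfl fun j hj => Finset.sum_congr rfl fun k hk => by rw [h j hj k hk]

/-- The distances from a point `x` to the points `p i`, `i ∈ N`, are those of an affine combination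
of the points (the foot of `x` on their affine span) raised by a height `h`. For empty `N` the
weights `c` cannot sum to `1`, but the height can be taken to be nonzero. -/
theorem exists_affine_foot {ι E : Type*} [NormedAddCommGroup E] [InnerProductSpace ℝ E]
    [FiniteDimensional ℝ E] (p : ι → E) (N : Finset ι) (x : E) :
    ∃ (c : ι → ℝ) (h : ℝ), (∀ i, i ∉ N → c i = 0) ∧ (N.Nonempty ∨ h = 0 → ∑ i ∈ N, c i = 1) ∧
      ∀ i ∈ N, ‖x - p i‖ ^ 2 = ‖∑ j ∈ N, c j • p j - p i‖ ^ 2 + h ^ 2 := by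
  classical
  rcases N.eq_empty_or_nonempty with rfl | hN
  · exact ⟨0, 1, by simp, by simp, by simp⟩
  set s := affineSpan ℝ (p '' (N : Set ι)) with hs
  have : Nonempty s := by
    obtain ⟨i, hi⟩ := hN
    exact ⟨⟨p i, subset_affineSpan ℝ _ ⟨i, hi, rfl⟩⟩⟩
  obtain ⟨fs, w, hfs, hw, hx⟩ := eq_affineCombination_of_mem_affineSpan_image
    (EuclideanGeometry.orthogonalProjection s x).2
  have hfs' : fs ⊆ N := by simpa using hfs
  set c : ι → ℝ := fun i => if i ∈ fs then w i else 0 with hc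
  have hcsum : ∑ i ∈ N, c i = 1 := by
    rw [← hw, hc, ← Finset.sum_filter, Finset.filter_mem_eq_inter, Finset.inter_eq_right.mpr hfs']
  have hfoot : ((EuclideanGeometry.orthogonalProjection s x : s) : E) = ∑ j ∈ N, c j • p j := by
    rw [hx, Finset.affineCombination_eq_linear_combination _ _ _ hw]
    simp only [hc, ite_smul, zero_smul]
    rw [← Finset.sum_filter, Finset.filter_mem_eq_inter, Finset.inter_eq_right.mpr hfs']
  refine ⟨c, dist x (EuclideanGeometry.orthogonalProjection s x : s), ?_, fun _ => hcsum, ?_⟩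
  · intro i hi
    exact if_neg fun h => hi (hfs' h)
  · intro i hi
    have hpi : p i ∈ s := subset_affineSpan ℝ _ ⟨i, hi, rfl⟩
    have := EuclideanGeometry.dist_sq_eq_dist_orthogonalProjection_sq_add_dist_orthogonalProjection_sq
      x hpi
    rw [← hfoot, ← dist_eq_norm, ← dist_eq_norm, dist_comm x (p i), dist_comm _ (p i)]
    linarith

/-- `IsComplementaryPair G p e S q W`: on the vertex set `S`, the configuration `q` has the edge
lengths of `p`, and the rows of `W` are the linear forms whose squares add up to a PSD stress matrix
`Wᵀ W` that is strictly complementary to `q`. Each form is supported on a clique of `G` and vanishes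
on the affine functions of `q`, and only these functions are annihilated by all the forms.
The coordinates `e c`, `c ∉ S`, are not yet used by `q`. -/
structure IsComplementaryPair {V : Type*} [Fintype V] (G : SimpleGraph V) {d n : ℕ}
    (p : V → EuclideanSpace ℝ (Fin d)) (e : V → Fin n) (S : Finset V)
    (q : V → EuclideanSpace ℝ (Fin n)) (W : V → V → ℝ) : Prop where
  apply_eq_zero : ∀ k i, k ∉ S ∨ i ∉ S → W k i = 0
  adj : ∀ k i j, i ≠ j → W k i ≠ 0 → W k j ≠ 0 → G.Adj i j
  sum_row : ∀ k, ∑ i, W k i = 0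
  sum_row_smul : ∀ k, ∑ i, W k i • q i = 0
  norm_sub : ∀ i ∈ S, ∀ j ∈ S, G.Adj i j → ‖q i - q j‖ = ‖p i - p j‖
  exists_affine : ∀ x : V → ℝ, (∀ k, ∑ i, W k i * x i = 0) →
    ∃ (b : ℝ) (a : EuclideanSpace ℝ (Fin n)), ∀ i ∈ S, x i = b + ⟪a, q i⟫_ℝ
  coord_eq_zero : ∀ i ∈ S, ∀ c, c ∉ S → q i (e c) = 0

/-- A complementary pair extends to a further vertex `v` whose neighbours `N` in `S` form a clique.
If the point `p v` lies off the affine span of the points of `N`, the vertex is placed in a new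
dimension and no form is added. Otherwise `v` is placed at the corresponding affine combination of
the points of `N`, and the form that expresses this dependence is added. -/
theorem IsComplementaryPair.exists_insert {V : Type*} [Fintype V] [DecidableEq V]
    {G : SimpleGraph V} {d n : ℕ} {p : V → EuclideanSpace ℝ (Fin d)} {e : V → Fin n}
    (he : Function.Injective e) {S : Finset V} {q : V → EuclideanSpace ℝ (Fin n)} {W : V → V → ℝ}
    (h : IsComplementaryPair G p e S q W) {v : V} (hv : v ∉ S)
    (hsimp : ∀ i ∈ S, ∀ j ∈ S, G.Adj v i → G.Adj v j → i ≠ j → G.Adj i j) :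
    ∃ q' W', IsComplementaryPair G p e (insert v S) q' W' := by
  classical
  set N := S.filter (G.Adj v) with hN
  have hNS : ∀ i ∈ N, i ∈ S := fun i hi => (Finset.mem_filter.mp hi).1
  have hNv : ∀ i ∈ N, G.Adj v i := fun i hi => (Finset.mem_filter.mp hi).2
  obtain ⟨c, t, hc0, hc1, hdist⟩ := exists_affine_foot p N (p v)
  set y := ∑ j ∈ N, c j • q j + t • EuclideanSpace.single (e v) (1 : ℝ) with hy
  set q' : V → EuclideanSpace ℝ (Fin n) := Function.update q v y with hq'
  have hq'v : q' v = y := Function.update_self ..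
  have hq'i : ∀ i ∈ S, q' i = q i := fun i hi =>
    Function.update_of_ne (ne_of_mem_of_not_mem hi hv) ..
  have hrow : ∀ k, ∑ i, W k i • q' i = 0 := by
    intro k
    rw [← h.sum_row_smul k]
    refine Finset.sum_congr rfl fun i _ => ?_
    by_cases hi : i ∈ S
    · rw [hq'i i hi]
    · rw [h.apply_eq_zero k i (Or.inr hi), zero_smul, zero_smul]
  have hNq : ∀ i ∈ N, ∀ j ∈ N, ‖q i - q j‖ = ‖p i - p j‖ := by
    intro i hi j hj
    by_cases hij : i = j
    · simp [hij]
    · exact h.norm_sub i (hNS i hi) j (hNS j hj)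
        (hsimp i (hNS i hi) j (hNS j hj) (hNv i hi) (hNv j hj) hij)
  have hyq : ∀ i ∈ N, ‖y - q i‖ = ‖p v - p i‖ := by
    intro i hi
    have horth : ⟪∑ j ∈ N, c j • q j - q i, t • EuclideanSpace.single (e v) (1 : ℝ)⟫_ℝ = 0 := by
      have h1 : ∀ j ∈ N, q j (e v) = 0 := fun j hj => h.coord_eq_zero j (hNS j hj) v hv
      rw [inner_smul_right, EuclideanSpace.inner_single_right]
      simp only [PiLp.sub_apply, WithLp.ofLp_sum, Finset.sum_apply, PiLp.smul_apply, h1 i hi]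
      rw [Finset.sum_eq_zero fun j hj => by simp [h1 j hj]]
      simp
    have h2 : ‖y - q i‖ ^ 2 = ‖p v - p i‖ ^ 2 := by
      rw [hdist i hi, hy, add_sub_right_comm, norm_add_sq_real, horth,
        norm_sum_smul_sub_eq_of_norm_sub_eq p q N c (hc1 (Or.inl ⟨i, hi⟩)) hNq hi, norm_smul]
      simp
    exact (sq_eq_sq₀ (norm_nonneg _) (norm_nonneg _)).mp h2
  have hnorm : ∀ i ∈ insert v S, ∀ j ∈ insert v S, G.Adj i j → ‖q' i - q' j‖ = ‖p i - p j‖ := by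
    intro i hi j hj hij
    rcases Finset.mem_insert.mp hi with rfl | hiS
    · rcases Finset.mem_insert.mp hj with rfl | hjS
      · exact absurd rfl hij.ne
      · rw [hq'v, hq'i j hjS]
        exact hyq j (Finset.mem_filter.mpr ⟨hjS, hij⟩)
    · rcases Finset.mem_insert.mp hj with rfl | hjS
      · rw [hq'v, hq'i i hiS, norm_sub_rev, norm_sub_rev (p i)]
        exact hyq i (Finset.mem_filter.mpr ⟨hiS, hij.symm⟩)
      · rw [hq'i i hiS, hq'i j hjS]
        exact h.norm_sub i hiS j hjS hij
  have hcoord : ∀ i ∈ insert v S, ∀ k, k ∉ insert v S → q' i (e k) = 0 := by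
    intro i hi k hk
    rw [Finset.mem_insert, not_or] at hk
    rcases Finset.mem_insert.mp hi with rfl | hi
    · have hne : e k ≠ e i := fun h => hk.1 (he h)
      rw [hq'v, hy]
      simp only [PiLp.add_apply, WithLp.ofLp_sum, Finset.sum_apply, PiLp.smul_apply]
      rw [Finset.sum_eq_zero fun j hj => by rw [h.coord_eq_zero j (hNS j hj) k hk.2, smul_zero]]
      simp [hne]
    · rw [hq'i i hi]
      exact h.coord_eq_zero i hi k hk.2
  have hWv : ∀ i, W v i = 0 := fun i => h.apply_eq_zero v i (Or.inl hv)
  by_cases ht : t = 0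
  · set r : V → ℝ := fun i => (if i = v then 1 else 0) - c i with hr
    have hsumN : ∀ {M : Type} [AddCommGroup M] [Module ℝ M] (f : V → M),
        ∑ i, c i • f i = ∑ i ∈ N, c i • f i := by
      intro M _ _ f
      refine (Finset.sum_subset (Finset.subset_univ N) fun i _ hi => ?_).symm
      rw [hc0 i hi, zero_smul]
    have hvN : v ∉ N := fun hvN => hv (hNS v hvN)
    have hrsupp : ∀ i, r i ≠ 0 → i = v ∨ i ∈ N := by
      intro i hi
      by_contra! hcon
      exact hi (by simp [hr, hcon.1, hc0 i hcon.2])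
    have hsumr : ∀ x : V → ℝ, ∑ i, r i * x i = x v - ∑ i ∈ N, c i * x i := by
      intro x
      have := hsumN x
      simp only [smul_eq_mul] at this
      simp [hr, sub_mul, Finset.sum_sub_distrib, this]
    refine ⟨q', Function.update W v r, ?_, ?_, ?_, ?_, hnorm, ?_, hcoord⟩
    · intro k i hki
      by_cases hk : k = v
      · subst hk
        rw [Function.update_self]
        by_contra hne
        rcases hki with hki | hki
        · exact hki (Finset.mem_insert_self _ _)
        · rcases hrsupp i hne with rfl | hi
          · exact hki (Finset.mem_insert_self _ _)
          · exact hki (Finset.mem_insert_of_mem (hNS i hi))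
      · rw [Function.update_of_ne hk]
        exact h.apply_eq_zero k i (hki.imp (fun h1 h2 => h1 (Finset.mem_insert_of_mem h2))
          fun h1 h2 => h1 (Finset.mem_insert_of_mem h2))
    · intro k i j hij hi hj
      by_cases hk : k = v
      · subst hk
        rw [Function.update_self] at hi hj
        rcases hrsupp i hi with rfl | hi
        · rcases hrsupp j hj with rfl | hj
          · exact absurd rfl hij
          · exact hNv j hj
        · rcases hrsupp j hj with rfl | hj
          · exact (hNv i hi).symm
          · exact hsimp i (hNS i hi) j (hNS j hj) (hNv i hi) (hNv j hj) hij
      · rw [Function.update_of_ne hk] at hi hj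
        exact h.adj k i j hij hi hj
    · intro k
      by_cases hk : k = v
      · subst hk
        rw [Function.update_self]
        have := hsumr 1
        simpa [hc1 (Or.inr ht)] using this
      · rw [Function.update_of_ne hk]
        exact h.sum_row k
    · intro k
      by_cases hk : k = v
      · subst hk
        rw [Function.update_self]
        simp only [hr, sub_smul, Finset.sum_sub_distrib, ite_smul, one_smul, zero_smul,
          Finset.sum_ite_eq', Finset.mem_univ, if_true, hsumN, hq'v]
        rw [Finset.sum_congr rfl fun i hi => by rw [hq'i i (hNS i hi)], hy, ht]
        simp
      · rw [Function.update_of_ne hk]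
        exact hrow k
    · intro x hx
      obtain ⟨b, a, hab⟩ := h.exists_affine x fun k => by
        by_cases hk : k = v
        · simp [hk, hWv]
        · simpa [Function.update_of_ne hk] using hx k
      have hxv : x v = ∑ i ∈ N, c i * x i := by
        have := hx v
        rw [Function.update_self, hsumr] at this
        linarith
      refine ⟨b, a, fun i hi => ?_⟩
      rcases Finset.mem_insert.mp hi with rfl | hi
      · rw [hxv, hq'v, hy, ht, zero_smul, add_zero, inner_sum,
          Finset.sum_congr rfl fun j hj => by rw [hab j (hNS j hj), mul_add],
          Finset.sum_add_distrib, ← Finset.sum_mul, hc1 (Or.inr ht), one_mul]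
        simp only [inner_smul_right]
      · rw [hq'i i hi]
        exact hab i hi
  · refine ⟨q', W, ?_, h.adj, h.sum_row, hrow, hnorm, ?_, hcoord⟩
    · intro k i hki
      exact h.apply_eq_zero k i (hki.imp (fun h1 h2 => h1 (Finset.mem_insert_of_mem h2))
        fun h1 h2 => h1 (Finset.mem_insert_of_mem h2))
    · intro x hx
      obtain ⟨b, a, hab⟩ := h.exists_affine x hx
      -- the slope in the new dimension is chosen to produce the value `x v`
      refine ⟨b, a + ((x v - b - ⟪a, y⟫_ℝ) / t) • EuclideanSpace.single (e v) (1 : ℝ),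
        fun i hi => ?_⟩
      rw [inner_add_left, inner_smul_left, EuclideanSpace.inner_single_left]
      rcases Finset.mem_insert.mp hi with rfl | hi
      · have hyv : y (e i) = t := by
          rw [hy]
          simp only [PiLp.add_apply, WithLp.ofLp_sum, Finset.sum_apply, PiLp.smul_apply]
          rw [Finset.sum_eq_zero fun j hj => by
            rw [h.coord_eq_zero j (hNS j hj) i hv, smul_zero]]
          simp
        rw [hq'v, hyv]
        simp only [conj_trivial, one_mul]
        field_simp
        ring
      · rw [hq'i i hi, h.coord_eq_zero i hi v hv, hab i hi]
        simp

/-- Every framework on a chordal graph has a complementary pair, built along a perfect elimination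
ordering. -/
theorem IsChordal.exists_isComplementaryPair {V : Type*} [Fintype V] [DecidableEq V]
    {G : SimpleGraph V} (hG : IsChordal G) {d n : ℕ} (p : V → EuclideanSpace ℝ (Fin d))
    {e : V → Fin n} (he : Function.Injective e) (S : Finset V) :
    ∃ q W, IsComplementaryPair G p e S q W := by
  induction S using Finset.strongInduction with
  | H S ih =>
  rcases S.eq_empty_or_nonempty with rfl | hS
  · exact ⟨0, 0, by simp, by simp, by simp, by simp, by simp, by simp, by simp⟩
  obtain ⟨v, hv, hsimp⟩ := hG.exists_simplicial S hS
  obtain ⟨q, W, h⟩ := ih _ (Finset.erase_ssubset hv)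
  have := h.exists_insert he (Finset.notMem_erase v S) fun i hi j hj =>
    hsimp i (Finset.mem_of_mem_erase hi) j (Finset.mem_of_mem_erase hj)
  rwa [Finset.insert_erase hv] at this

/-! ### Facial reduction and minimal faces -/

/-- Facial reduction passes through faces that contain the feasible region. -/
theorem FacialReduction.isFace_and_feasibleRegion_subset {E F : Type*} [AddCommGroup E] [Module ℝ E]
    [NormedAddCommGroup F] [InnerProductSpace ℝ F] {K : ConvexCone ℝ E} {M : E →ₗ[ℝ] F} {b : F}
    {k : ℕ} {f : Set E} (h : FacialReduction K M b k f) :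
    IsFace (K : Set E) f ∧ feasibleRegion K M b ⊆ f := by
  induction h with
  | start => exact ⟨⟨K.convex, IsExtreme.rfl⟩, fun X hX => hX.1⟩
  | step v _ hv ih =>
    obtain ⟨⟨hconv, hext⟩, hsub⟩ := ih
    refine ⟨⟨?_, ?_, ?_⟩, fun X hX => ⟨hsub hX, by rw [hX.2]; exact hv.2.2⟩⟩
    · intro X hX Y hY s t hs ht hst
      refine ⟨hconv hX.1 hY.1 hs ht hst, ?_⟩
      rw [map_add, map_smul, map_smul, inner_add_right, inner_smul_right, inner_smul_right, hX.2,
        hY.2, mul_zero, mul_zero, add_zero]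
    · exact fun X hX => hext.subset hX.1
    · intro X hX Y hY Z hZ hmem
      have hXf := hext.left_mem_of_mem_openSegment hX hY hZ.1 hmem
      have hYf := hext.right_mem_of_mem_openSegment hX hY hZ.1 hmem
      refine ⟨hXf, ?_⟩
      obtain ⟨s, t, hs, ht, -, rfl⟩ := hmem
      have h0 := hZ.2
      rw [map_add, map_smul, map_smul, inner_add_right, inner_smul_right, inner_smul_right] at h0
      have h1 := hv.1 X hXf
      have h2 := hv.1 Y hYf
      have h3 := mul_nonneg ht.le h2
      exact le_antisymm (by_contra fun hlt => by nlinarith [mul_pos hs (not_le.mp hlt)]) h1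

theorem FacialReduction.eq_of_zero {E F : Type*} [AddCommGroup E] [Module ℝ E]
    [NormedAddCommGroup F] [InnerProductSpace ℝ F] {K : ConvexCone ℝ E} {M : E →ₗ[ℝ] F} {b : F}
    {f : Set E} (h : FacialReduction K M b 0 f) : f = K := by
  cases h
  rfl

/-- At the minimal face containing the feasible region no reducing certificate is left, since it
would cut out a smaller face. -/
theorem FacialReduction.not_isReducingCertificate {E F : Type*} [AddCommGroup E] [Module ℝ E]
    [NormedAddCommGroup F] [InnerProductSpace ℝ F] {K : ConvexCone ℝ E} {M : E →ₗ[ℝ] F} {b : F}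
    {k : ℕ} {f : Set E} (h : FacialReduction K M b k f)
    (hf : f = minFace (K : Set E) (feasibleRegion K M b)) (v : F) :
    ¬ IsReducingCertificate M b f v := by
  intro hv
  obtain ⟨X, hX, hne⟩ := hv.2.1
  rw [hf] at hX
  exact hne (Set.mem_sInter.mp hX _ (FacialReduction.step v h hv).isFace_and_feasibleRegion_subset).2

/-- A face of a convex cone that contains `X` contains everything that is dominated by a multiple
of `X`. -/
theorem IsFace.mem_of_smul_sub_mem {E : Type*} [AddCommGroup E] [Module ℝ E] {K : ConvexCone ℝ E}
    {f : Set E} (hf : IsFace (K : Set E) f) {X Y : E} (hX : X ∈ f) (hY : Y ∈ K) {C : ℝ}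
    (hC : 0 < C) (hXY : C • X - Y ∈ K) : Y ∈ f := by
  have hZ : C⁻¹ • (X + (C • X - Y)) ∈ K :=
    K.smul_mem (inv_pos.mpr hC) (K.add_mem (hf.2.subset hX) hXY)
  refine hf.2.left_mem_of_mem_openSegment hY hZ hX
    ⟨(C + 1)⁻¹, C / (C + 1), by positivity, by positivity, by field_simp; ring, ?_⟩
  match_scalars <;> field_simp <;> ring

/-! ### Stress matrices as reducing certificates -/

/-- The centered Gram matrix as an element of the space of symmetric matrices. -/
noncomputable def centeredGramSym {V : Type*} [Fintype V] {d : ℕ}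
    (p : V → EuclideanSpace ℝ (Fin d)) : SymMat V :=
  ⟨centeredGram p, by
    have h := (Matrix.isHermitian_gram ℝ fun i => p i - (Fintype.card V : ℝ)⁻¹ • ∑ j, p j).eq
    rwa [Matrix.conjTranspose_eq_transpose_of_trivial] at h⟩

theorem sum_sub_centroid {V : Type*} [Fintype V] {d : ℕ} (p : V → EuclideanSpace ℝ (Fin d)) :
    ∑ i, (p i - (Fintype.card V : ℝ)⁻¹ • ∑ j, p j) = 0 := by
  rcases isEmpty_or_nonempty V with hV | hV
  · simp
  · rw [Finset.sum_sub_distrib, Finset.sum_const, Finset.card_univ, ← Nat.cast_smul_eq_nsmul ℝ,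
      smul_smul, mul_inv_cancel₀ (by simp), one_smul, sub_self]

theorem centeredGramSym_mem {V : Type*} [Fintype V] {d : ℕ}
    (p : V → EuclideanSpace ℝ (Fin d)) :
    centeredGramSym p ∈ centeredPSD V := by
  refine ⟨Matrix.posSemidef_gram ℝ _, ?_⟩
  ext i
  have h := congrArg (inner ℝ (p i - (Fintype.card V : ℝ)⁻¹ • ∑ j, p j)) (sum_sub_centroid p)
  rw [inner_sum, inner_zero_right] at h
  simpa [centeredGramSym, centeredGram, Matrix.mulVec, dotProduct, Matrix.gram_apply] using h

theorem edgeProj_lindenstrauss_centeredGramSym {V : Type*} [Fintype V] (G : SimpleGraph V)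
    {d : ℕ} (p : V → EuclideanSpace ℝ (Fin d)) :
    edgeProj G (lindenstrauss V (centeredGramSym p)) = edgeSqDist G p := by
  ext ⟨e, he⟩
  induction e using Sym2.ind with
  | _ i j =>
    have h := norm_sub_sq_real (p i - (Fintype.card V : ℝ)⁻¹ • ∑ j, p j)
      (p j - (Fintype.card V : ℝ)⁻¹ • ∑ j, p j)
    rw [sub_sub_sub_cancel_right] at h
    simp only [edgeProj, lindenstrauss, centeredGramSym, centeredGram, edgeSqDist,
      Matrix.gram_apply, LinearMap.coe_mk, AddHom.coe_mk, Sym2.lift_mk, Matrix.of_apply,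
      real_inner_self_eq_norm_sq]
    rw [h]
    ring

section Graph

variable {V : Type*} [Fintype V] [DecidableEq V] (G : SimpleGraph V) [DecidableRel G.Adj]

/-- `Ω(ω)` is the image of `ω` under the adjoint of the edge measurement map. -/
theorem trace_stressMatrix_mul (ω : G.edgeSet → ℝ) (X : SymMat V) :
    (stressMatrix G ω * X.1).trace =
      ⟪(WithLp.toLp 2 ω : EuclideanSpace ℝ G.edgeSet), edgeProj G (lindenstrauss V X)⟫_ℝ := by
  have hw : ∀ i j, stressWeight G ω i j = ∑ e : G.edgeSet, if e.1 = s(i, j) then ω e else 0 := by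
    intro i j
    by_cases h : G.Adj i j
    · have hiff : ∀ e : G.edgeSet, e.1 = s(i, j) ↔ e = ⟨s(i, j), h⟩ := fun e => by
        rw [Subtype.ext_iff]
      simp [stressWeight, h, hiff]
    · rw [stressWeight, dif_neg h]
      refine (Finset.sum_eq_zero fun e _ => if_neg fun he => h ?_).symm
      rw [← SimpleGraph.mem_edgeSet, ← he]
      exact e.2
  have htr : (stressMatrix G ω * X.1).trace =
      ∑ i, ∑ j, stressWeight G ω i j * (X.1 i i - X.1 j i) := by
    rw [Matrix.trace]
    refine Finset.sum_congr rfl fun i _ => ?_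
    exact stressMatrix_mulVec G ω (fun j => X.1 j i) i
  rw [htr, PiLp.inner_apply]
  simp only [hw, Finset.sum_mul]
  rw [Finset.sum_congr rfl fun i _ => Finset.sum_comm, Finset.sum_comm]
  refine Finset.sum_congr rfl fun e _ => ?_
  obtain ⟨e, he⟩ := e
  induction e using Sym2.ind with
  | _ a b =>
    have hab : a ≠ b := (SimpleGraph.mem_edgeSet G |>.mp he).ne
    have hsplit : ∀ i j, (if s(a, b) = s(i, j) then ω ⟨s(a, b), he⟩ else 0) *
        (X.1 i i - X.1 j i) = (if a = i then if b = j then ω ⟨s(a, b), he⟩ *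
          (X.1 i i - X.1 j i) else 0 else 0) + (if b = i then if a = j then ω ⟨s(a, b), he⟩ *
          (X.1 i i - X.1 j i) else 0 else 0) := by
      intro i j
      simp only [Sym2.eq_iff]
      by_cases h1 : a = i <;> by_cases h2 : b = j <;> by_cases h3 : a = j <;>
        by_cases h4 : b = i <;> simp_all
    have hsym : X.1 b a = X.1 a b := Matrix.IsSymm.apply X.2 a b
    simp only [hsplit, Finset.sum_add_distrib, Finset.sum_ite_irrel, Finset.sum_const_zero,
      Finset.sum_ite_eq, Finset.mem_univ, if_true]
    simp [edgeProj, lindenstrauss, hsym]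
    ring

theorem trace_stressMatrix_mul_centeredGram {d : ℕ} (p : V → EuclideanSpace ℝ (Fin d))
    (ω : G.edgeSet → ℝ) : (stressMatrix G ω * centeredGram p).trace =
      ⟪(WithLp.toLp 2 ω : EuclideanSpace ℝ G.edgeSet), edgeSqDist G p⟫_ℝ := by
  rw [← edgeProj_lindenstrauss_centeredGramSym G p, ← trace_stressMatrix_mul]
  rfl

theorem isPSDStressOn_iff_isReducingCertificate {d : ℕ} (p : V → EuclideanSpace ℝ (Fin d))
    (f : Set (SymMat V)) (ω : G.edgeSet → ℝ) :
    IsPSDStressOn G p f ω ↔ IsReducingCertificate (edgeProj G ∘ₗ lindenstrauss V)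
      (edgeSqDist G p) f (WithLp.toLp 2 ω) := by
  simp only [IsPSDStressOn, IsReducingCertificate, trace_stressMatrix_mul_centeredGram,
    trace_stressMatrix_mul, LinearMap.comp_apply]
  tauto

theorem psdStressLevels_iff_facialReduction {d : ℕ} (p : V → EuclideanSpace ℝ (Fin d)) (k : ℕ)
    (f : Set (SymMat V)) :
    PSDStressLevels G p k f ↔ FacialReduction (centeredPSD V) (edgeProj G ∘ₗ lindenstrauss V)
      (edgeSqDist G p) k f := by
  constructor
  · intro h
    induction h with
    | start => exact .start
    | step ω _ hω ih =>
      have := ih.step _ ((isPSDStressOn_iff_isReducingCertificate G p _ ω).mp hω)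
      simpa only [trace_stressMatrix_mul, LinearMap.comp_apply] using this
  · intro h
    induction h with
    | start => exact .start
    | step v _ hv ih =>
      have := ih.step v.ofLp ((isPSDStressOn_iff_isReducingCertificate G p _ v.ofLp).mpr hv)
      simpa only [trace_stressMatrix_mul, LinearMap.comp_apply] using this

end Graph

/-! ### The strictly complementary stress matrix -/

/-- A symmetric matrix with zero row sums whose off-diagonal support lies in the edges of `G` is a
stress matrix. -/
theorem exists_stressMatrix_eq {V : Type*} [Fintype V] [DecidableEq V] (G : SimpleGraph V)
    [DecidableRel G.Adj] {A : Matrix V V ℝ} (hsymm : A.IsSymm)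
    (hadj : ∀ i j, i ≠ j → A i j ≠ 0 → G.Adj i j) (hsum : ∀ i, ∑ j, A i j = 0) :
    ∃ ω : G.edgeSet → ℝ, stressMatrix G ω = A := by
  refine ⟨fun e => Sym2.lift ⟨fun i j => -A i j,
    fun i j => congrArg Neg.neg (hsymm.apply j i)⟩ e.1, ?_⟩
  have hw : ∀ i j, stressWeight G (fun e => Sym2.lift ⟨fun i j => -A i j,
      fun i j => congrArg Neg.neg (hsymm.apply j i)⟩ e.1) i j = if i = j then 0 else -A i j := by
    intro i j
    by_cases hij : i = j
    · simp [stressWeight, hij]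
    · by_cases h : G.Adj i j
      · simp [stressWeight, h, hij]
      · have : A i j = 0 := by_contra fun hne => h (hadj i j hij hne)
        simp [stressWeight, h, this]
  ext i j
  by_cases hij : i = j
  · subst hij
    have h1 : ∀ k, (if i = k then 0 else -A i k) = (if i = k then A i k else 0) - A i k := by
      intro k
      split_ifs <;> ring
    simp [stressMatrix, hw, h1, Finset.sum_sub_distrib, hsum]
  · simp [stressMatrix, hw, hij]

open scoped MatrixOrder in
/-- If `W, q` is a complementary pair, then every centered PSD matrix orthogonal to `Wᵀ W` is
dominated by a multiple of the Gram matrix of `q`: it is a sum of squares of affine functions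
of `q`. -/
theorem IsComplementaryPair.exists_smul_sub_mem {V : Type*} [Fintype V] {G : SimpleGraph V}
    {d n : ℕ} {p : V → EuclideanSpace ℝ (Fin d)} {e : V → Fin n}
    {q : V → EuclideanSpace ℝ (Fin n)} {W : V → V → ℝ}
    (h : IsComplementaryPair G p e Finset.univ q W) {Y : SymMat V} (hY : Y ∈ centeredPSD V)
    (hWY : ((Matrix.of W)ᵀ * Matrix.of W * Y.1).trace = 0) :
    ∃ C : ℝ, 0 < C ∧ C • centeredGramSym q - Y ∈ centeredPSD V := by
  classical
  obtain ⟨B, hB⟩ := CStarAlgebra.nonneg_iff_eq_star_mul_self.mp hY.1.nonneg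
  rw [Matrix.star_eq_conjTranspose, Matrix.conjTranspose_eq_transpose_of_trivial] at hB
  have hB1 : B *ᵥ 1 = 0 := by
    have h1 := hY.2
    rw [hB, ← Matrix.conjTranspose_eq_transpose_of_trivial] at h1
    exact (Matrix.conjTranspose_mul_self_mulVec_eq_zero B 1).mp h1
  have hWB : Matrix.of W * Bᵀ = 0 := by
    rw [← Matrix.trace_conjTranspose_mul_self_eq_zero_iff,
      Matrix.conjTranspose_eq_transpose_of_trivial, Matrix.transpose_mul, Matrix.transpose_transpose,
      ← hWY, hB, Matrix.mul_assoc, Matrix.trace_mul_comm]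
    simp only [Matrix.mul_assoc]
  set qc : V → EuclideanSpace ℝ (Fin n) :=
    fun i => q i - (Fintype.card V : ℝ)⁻¹ • ∑ j, q j with hqc
  have hqc0 : ∑ i, qc i = 0 := sum_sub_centroid q
  have hrow : ∀ k, ∃ a : EuclideanSpace ℝ (Fin n), ∀ i, B k i = ⟪a, qc i⟫_ℝ := by
    intro k
    obtain ⟨b, a, hab⟩ := h.exists_affine (B k) fun l => by
      simpa [Matrix.mul_apply] using congrFun (congrFun hWB l) k
    set b' := b + ⟪a, (Fintype.card V : ℝ)⁻¹ • ∑ j, q j⟫_ℝ with hb'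
    have hab' : ∀ i, B k i = b' + ⟪a, qc i⟫_ℝ := by
      intro i
      rw [hab i (Finset.mem_univ i), hb', hqc, inner_sub_right]
      ring
    have hsum : ∑ i, B k i = 0 := by
      simpa [Matrix.mulVec, dotProduct] using congrFun hB1 k
    rw [Finset.sum_congr rfl fun i _ => hab' i, Finset.sum_add_distrib, ← inner_sum, hqc0,
      inner_zero_right, add_zero, Finset.sum_const, Finset.card_univ, nsmul_eq_mul] at hsum
    refine ⟨a, fun i => ?_⟩
    have hne : (Fintype.card V : ℝ) ≠ 0 := by
      have : Nonempty V := ⟨i⟩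
      simp
    rw [hab' i, (mul_eq_zero.mp hsum).resolve_left hne, zero_add]
  choose a ha using hrow
  have hC : 0 < ∑ k, ‖a k‖ ^ 2 + 1 := by positivity
  refine ⟨∑ k, ‖a k‖ ^ 2 + 1, hC, ?_, ?_⟩
  · refine Matrix.PosSemidef.of_dotProduct_mulVec_nonneg ?_ fun x => ?_
    · rw [Matrix.IsHermitian, Matrix.conjTranspose_eq_transpose_of_trivial]
      exact (_ • centeredGramSym q - Y).2
    · have hX : x ⬝ᵥ ((centeredGramSym q).1 *ᵥ x) = ‖∑ i, x i • qc i‖ ^ 2 := by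
        rw [← real_inner_self_eq_norm_sq, sum_inner]
        simp only [inner_sum, inner_smul_left, inner_smul_right, dotProduct, Matrix.mulVec,
          centeredGramSym, centeredGram, Matrix.gram_apply, conj_trivial, Finset.mul_sum]
        exact Finset.sum_congr rfl fun i _ => Finset.sum_congr rfl fun j _ => by
          simp only [hqc]
          ring
      have hYx : x ⬝ᵥ (Y.1 *ᵥ x) = ∑ k, ⟪a k, ∑ i, x i • qc i⟫_ℝ ^ 2 := by
        rw [hB, ← Matrix.mulVec_mulVec, Matrix.dotProduct_mulVec, Matrix.vecMul_transpose]
        refine Finset.sum_congr rfl fun k _ => ?_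
        have : (B *ᵥ x) k = ⟪a k, ∑ i, x i • qc i⟫_ℝ := by
          rw [inner_sum]
          refine Finset.sum_congr rfl fun i _ => ?_
          change B k i * x i = _
          rw [ha k i, inner_smul_right, mul_comm]
        rw [this, sq]
      have hle : ∑ k, ⟪a k, ∑ i, x i • qc i⟫_ℝ ^ 2 ≤
          (∑ k, ‖a k‖ ^ 2) * ‖∑ i, x i • qc i‖ ^ 2 := by
        rw [Finset.sum_mul]
        refine Finset.sum_le_sum fun k _ => ?_
        rw [← mul_pow, ← sq_abs]
        gcongr
        exact abs_real_inner_le_norm _ _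
      change 0 ≤ star x ⬝ᵥ (((∑ k, ‖a k‖ ^ 2 + 1) • (centeredGramSym q).1 - Y.1) *ᵥ x)
      rw [star_trivial, Matrix.sub_mulVec, Matrix.smul_mulVec, dotProduct_sub, dotProduct_smul,
        hX, hYx, smul_eq_mul]
      nlinarith [sq_nonneg ‖∑ i, x i • qc i‖]
  · change ((∑ k, ‖a k‖ ^ 2 + 1) • (centeredGramSym q).1 - Y.1) *ᵥ 1 = 0
    rw [Matrix.sub_mulVec, Matrix.smul_mulVec, (centeredGramSym_mem q).2, hY.2, smul_zero, sub_zero]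

/-- On a chordal graph a single stress, whose matrix is positive semidefinite and possibly zero,
cuts out the minimal face of the EDM completion problem. -/
theorem IsChordal.exists_stress_eq_minFace {V : Type*} [Fintype V] [DecidableEq V]
    {G : SimpleGraph V} [DecidableRel G.Adj] (hG : IsChordal G) {d : ℕ}
    (p : V → EuclideanSpace ℝ (Fin d)) :
    ∃ ω : G.edgeSet → ℝ, (stressMatrix G ω).PosSemidef ∧
      (stressMatrix G ω * centeredGram p).trace = 0 ∧
      {X : SymMat V | X ∈ (centeredPSD V : Set (SymMat V)) ∧ (stressMatrix G ω * X.1).trace = 0} =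
        minFace (centeredPSD V : Set (SymMat V)) (feasibleRegion (centeredPSD V)
          (edgeProj G ∘ₗ lindenstrauss V) (edgeSqDist G p)) := by
  obtain ⟨q, W, h⟩ := hG.exists_isComplementaryPair p (Fintype.equivFin V).injective Finset.univ
  set A := Matrix.of W with hA
  have hpsd : (Aᵀ * A).PosSemidef := by
    rw [← Matrix.conjTranspose_eq_transpose_of_trivial]
    exact Matrix.posSemidef_conjTranspose_mul_self A
  obtain ⟨ω, hω⟩ := exists_stressMatrix_eq G (A := Aᵀ * A)
    (by rw [Matrix.IsSymm, Matrix.transpose_mul, Matrix.transpose_transpose])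
    (fun i j hij hne => by
      rw [Matrix.mul_apply] at hne
      obtain ⟨k, -, hk⟩ := Finset.exists_ne_zero_of_sum_ne_zero hne
      exact h.adj k i j hij (left_ne_zero_of_mul hk) (right_ne_zero_of_mul hk))
    (fun i => by
      simp only [Matrix.mul_apply]
      rw [Finset.sum_comm]
      refine Finset.sum_eq_zero fun k _ => ?_
      rw [← Finset.mul_sum]
      exact mul_eq_zero_of_right _ (h.sum_row k))
  have hq : edgeSqDist G q = edgeSqDist G p := by
    ext ⟨e, he⟩
    induction e using Sym2.ind with
    | _ i j =>
      simp [edgeSqDist, h.norm_sub i (Finset.mem_univ i) j (Finset.mem_univ j) he]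
  have hωq : (stressMatrix G ω * centeredGram q).trace = 0 := by
    rw [trace_mul_centeredGram, hω]
    refine Finset.sum_eq_zero fun c _ => ?_
    have : A *ᵥ (fun i => q i c) = 0 := by
      ext k
      have := congrArg (fun z : EuclideanSpace ℝ (Fin _) => z c) (h.sum_row_smul k)
      simpa [hA, Matrix.mulVec, dotProduct] using this
    rw [← Matrix.mulVec_mulVec, this, Matrix.mulVec_zero, dotProduct_zero]
  have hωp : (stressMatrix G ω * centeredGram p).trace = 0 := by
    rw [trace_stressMatrix_mul_centeredGram, ← hq, ← trace_stressMatrix_mul_centeredGram, hωq]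
  refine ⟨ω, hω ▸ hpsd, hωp, Set.Subset.antisymm ?_ ?_⟩
  · rintro Y ⟨hY, hωY⟩
    rw [hω] at hωY
    obtain ⟨C, hC, hmem⟩ := h.exists_smul_sub_mem hY hωY
    rintro f ⟨hf, hsub⟩
    refine hf.mem_of_smul_sub_mem (hsub ⟨centeredGramSym_mem q, ?_⟩) hY hC hmem
    rw [LinearMap.comp_apply, edgeProj_lindenstrauss_centeredGramSym, hq]
  · -- the set is the face reached by a facial reduction with at most one step
    by_cases hne : ∃ X ∈ (centeredPSD V : Set (SymMat V)), (stressMatrix G ω * X.1).trace ≠ 0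
    · have hlev : PSDStressLevels G p 1 {X : SymMat V | X ∈ (centeredPSD V : Set (SymMat V)) ∧
          (stressMatrix G ω * X.1).trace = 0} := PSDStressLevels.start.step ω
        ⟨hωp, fun X hX => trace_mul_nonneg_of_posSemidef (hω ▸ hpsd) hX.1, hne⟩
      exact Set.sInter_subset_of_mem
        ((psdStressLevels_iff_facialReduction G p _ _).mp hlev).isFace_and_feasibleRegion_subset
    · push Not at hne
      exact (Set.sInter_subset_of_mem FacialReduction.start.isFace_and_feasibleRegion_subset).trans
        fun X hX => ⟨hX, hne X hX⟩

theorem mainTheorem12 {V : Type*} [Fintype V] [DecidableEq V] (G : SimpleGraph V)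
    [DecidableRel G.Adj] (hG : IsChordal G) {d : ℕ} (p : V → EuclideanSpace ℝ (Fin d)) :
    psdStressLevel G p ≤ 1 ∧
      edmSingularityDegree G (edgeSqDist G p) ≤ 1 ∧
      psdStressLevel G p = edmSingularityDegree G (edgeSqDist G p) := by
  obtain ⟨ω, hpsd, hωp, hface⟩ := hG.exists_stress_eq_minFace p
  -- a face reached by facial reduction admits no further stress once it is minimal
  have hmaximal : ∀ {k f}, FacialReduction (centeredPSD V) (edgeProj G ∘ₗ lindenstrauss V)
      (edgeSqDist G p) k f → f = minFace (centeredPSD V : Set (SymMat V))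
        (feasibleRegion (centeredPSD V) (edgeProj G ∘ₗ lindenstrauss V) (edgeSqDist G p)) →
      ¬ ∃ ω, IsPSDStressOn G p f ω := fun hf hmin ⟨ω', hω'⟩ =>
    hf.not_isReducingCertificate hmin _ ((isPSDStressOn_iff_isReducingCertificate G p _ ω').mp hω')
  have hpos : ∀ X ∈ (centeredPSD V : Set (SymMat V)), 0 ≤ (stressMatrix G ω * X.1).trace :=
    fun X hX => trace_mul_nonneg_of_posSemidef hpsd hX.1
  -- both invariants are bounded by the length of a facial reduction to the minimal face
  have hbound : ∀ {k f}, FacialReduction (centeredPSD V) (edgeProj G ∘ₗ lindenstrauss V)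
      (edgeSqDist G p) k f → f = minFace (centeredPSD V : Set (SymMat V))
        (feasibleRegion (centeredPSD V) (edgeProj G ∘ₗ lindenstrauss V) (edgeSqDist G p)) →
      psdStressLevel G p ≤ k ∧ edmSingularityDegree G (edgeSqDist G p) ≤ k := fun {k f} hf hmin =>
    ⟨iInf₂_le k ⟨f, (psdStressLevels_iff_facialReduction G p k f).mpr hf, hmaximal hf hmin⟩,
      iInf₂_le k (hmin ▸ hf)⟩
  by_cases hne : ∃ X ∈ (centeredPSD V : Set (SymMat V)), (stressMatrix G ω * X.1).trace ≠ 0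
  · have hω : IsPSDStressOn G p (centeredPSD V : Set (SymMat V)) ω := ⟨hωp, hpos, hne⟩
    have hred := (psdStressLevels_iff_facialReduction G p _ _).mp (PSDStressLevels.start.step ω hω)
    obtain ⟨h1, h2⟩ := hbound hred hface
    rw [zero_add, Nat.cast_one] at h1 h2
    -- the whole cone still admits the stress `ω`, so no sequence of length zero is complete
    have h3 : 1 ≤ psdStressLevel G p := by
      refine le_iInf₂ fun k hk => ?_
      obtain ⟨f, hf, hmax⟩ := hk
      cases hf with
      | start => exact absurd ⟨ω, hω⟩ hmax
      | step => exact_mod_cast Nat.le_add_left 1 _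
    have h4 : 1 ≤ edmSingularityDegree G (edgeSqDist G p) := by
      refine le_iInf₂ fun k hk => ?_
      rcases k with _ | k
      · exact absurd ⟨ω, hω⟩ (hmaximal .start hk.eq_of_zero.symm)
      · exact_mod_cast Nat.le_add_left 1 k
    exact ⟨h1, h2, (le_antisymm h1 h3).trans (le_antisymm h2 h4).symm⟩
  · push Not at hne
    have hK : (centeredPSD V : Set (SymMat V)) = minFace (centeredPSD V : Set (SymMat V))
        (feasibleRegion (centeredPSD V) (edgeProj G ∘ₗ lindenstrauss V) (edgeSqDist G p)) := by
      rw [← hface]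
      exact Set.Subset.antisymm (fun X hX => ⟨hX, hne X hX⟩) fun X hX => hX.1
    obtain ⟨h1, h2⟩ := hbound .start hK
    rw [Nat.cast_zero, nonpos_iff_eq_zero] at h1 h2
    rw [h1, h2]
    exact ⟨zero_le_one, zero_le_one, rfl⟩
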